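/- Let $r\ge 2$ and let $\Gamma_1,\dots,\Gamma_r$ be nontrivial groups, where $\Gamma_i$ is generated by a finite symmetric set $S_i$; exclude the case $r=2=|\Gamma_1|=|\Gamma_2|$. Let $\mathcal X_i$ be the Cayley graph of $\Gamma_i$ with respect to $S_i$, let $\Gamma=\Gamma_1*\dots*\Gamma_r$ be the free product with identity $e$, and let $\mathcal X$ be the Cayley graph of $\Gamma$ with respect to $\bigcup_i S_i$, with graph distance $l(x)$ of $x$ to $e$. A ray is a one-sided infinite path without repeated vertices. Two rays are equivalent if some third ray shares infinitely many vertices with each of them, and an end is an equivalence class of rays. Let $\Omega$ be the set of ends of $\mathcal X$. For $1\le i\le r$ let $\Omega_i\subseteq\Omega$ be the set of all ends $x\omega$, where $x\in\Gamma$, $\omega$ is an end of $\mathcal X_i$, and $x\omega$ is the end represented by $(xy_n)_{n\ge0}$ for any ray $(y_n)_{n\ge0}$ in $\omega$. Let $\Omega_\infty\subseteq\Omega$ be the set of ends described by infinite words $x_1x_2x_3\dots$, where each $x_j$ is a non-identity element of one of the $\Gamma_k$ and consecutive letters lie in different factors; the end described by $x_1x_2x_3\dots$ is the one represented by any ray that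 passes through all the prefixes $x_1\cdots x_n$, $n\ge0$. Fix $\alpha\in(0,1)$. For distinct $\omega_1,\omega_2\in\Omega$ put $d(\omega_1,\omega_2)=\alpha^{c(\omega_1,\omega_2)}$, where $c(\omega_1,\omega_2)$ is the largest $m\ge0$ such that $\omega_1$ and $\omega_2$ lie in the same connected component of $\mathcal X\setminus\{x\in\Gamma: l(x)\le m-1\}$, and put $d(\omega,\omega)=0$. For $A\subseteq\Omega$ and $\delta\ge0$ let $$\mathcal H_\delta(A)=\lim_{\varepsilon\downarrow0}\ \inf\Bigl\{\sum_k\varepsilon_k^{\delta}\Bigr\},$$ where the infimum is over all finite or countable covers of $A$ by balls $\{\omega:d(\omega_k,\omega)\le\varepsilon_k\}$ with $\omega_k\in A$ and $0<\varepsilon_k<\varepsilon$, and let $\mathrm{HD}(A)=\inf\{\delta\ge0:\mathcal H_\delta(A)=0\}$ be the Hausdorff dimension. Then, for every $i\in\{1,\dots,r\}$, $$\mathrm{HD}(\Omega_i)<\mathrm{HD}(\Omega_\infty).$$ -/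

import Mathlib

open scoped ENNReal NNReal

noncomputable section

/-! ### Ends of a graph -/

section GraphEnds

variable {V W : Type*}

/-- A ray: a one-sided infinite path that visits no vertex twice. It may start at any vertex; in a
connected graph every ray is equivalent to one that starts at a prescribed root. -/
structure GraphRay (G : SimpleGraph V) where
  vertex : ℕ → V
  adj : ∀ n, G.Adj (vertex n) (vertex (n + 1))
  injective : Function.Injective vertex

/-- Two rays are equivalent if there is a third ray that shares infinitely many vertices with each
of them. -/
def GraphRay.Equivalent {G : SimpleGraph V} (ρ₁ ρ₂ : GraphRay G) : Prop :=
  ∃ ρ₃ : GraphRay G,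
    (Set.range ρ₃.vertex ∩ Set.range ρ₁.vertex).Infinite ∧
    (Set.range ρ₃.vertex ∩ Set.range ρ₂.vertex).Infinite

/-- The set of ends of a graph: the classes of equivalent rays. -/
def GraphEnd (G : SimpleGraph V) : Type _ :=
  Quot (GraphRay.Equivalent (G := G))

/-- The end represented by a ray. -/
def GraphRay.toEnd {G : SimpleGraph V} (ρ : GraphRay G) : GraphEnd G :=
  Quot.mk _ ρ

/-- The image of a ray under an injective graph homomorphism. -/
def GraphRay.map {G : SimpleGraph V} {H : SimpleGraph W} (f : G →g H)
    (hf : Function.Injective f) (ρ : GraphRay G) : GraphRay H where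
  vertex n := f (ρ.vertex n)
  adj n := f.map_adj (ρ.adj n)
  injective := hf.comp ρ.injective

theorem GraphRay.Equivalent.map {G : SimpleGraph V} {H : SimpleGraph W} (f : G →g H)
    (hf : Function.Injective f) {ρ₁ ρ₂ : GraphRay G} (h : ρ₁.Equivalent ρ₂) :
    (ρ₁.map f hf).Equivalent (ρ₂.map f hf) := by
  have key : ∀ ρ σ : GraphRay G, (Set.range ρ.vertex ∩ Set.range σ.vertex).Infinite →
      (Set.range (ρ.map f hf).vertex ∩ Set.range (σ.map f hf).vertex).Infinite := by
    intro ρ σ hi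
    refine (hi.image hf.injOn).mono ?_
    rintro _ ⟨v, ⟨⟨a, rfl⟩, ⟨b, hb⟩⟩, rfl⟩
    exact ⟨⟨a, rfl⟩, ⟨b, congrArg f hb⟩⟩
  obtain ⟨ρ₃, h₁, h₂⟩ := h
  exact ⟨ρ₃.map f hf, key _ _ h₁, key _ _ h₂⟩

/-- The map on ends induced by an injective graph homomorphism. -/
def GraphEnd.map {G : SimpleGraph V} {H : SimpleGraph W} (f : G →g H)
    (hf : Function.Injective f) : GraphEnd G → GraphEnd H :=
  Quot.map (GraphRay.map f hf) fun _ _ h => h.map f hf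

/-- An end is contained in a set of vertices if each of its representatives has all but finitely
many of its vertices in that set. -/
def GraphEnd.ContainedIn {G : SimpleGraph V} (ω : GraphEnd G) (A : Set V) : Prop :=
  ∀ ρ : GraphRay G, ρ.toEnd = ω → {n | ρ.vertex n ∉ A}.Finite

/-- The two ends lie in the same connected component of the graph that remains when all vertices
at distance less than `m` from the root `o` are removed (nothing is removed if `m = 0`). -/
def GraphEnd.SameComponent {G : SimpleGraph V} (o : V) (m : ℕ) (ω₁ ω₂ : GraphEnd G) : Prop :=
  ∃ C : G.ComponentCompl {v | G.dist o v < m},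
    ω₁.ContainedIn (C : Set V) ∧ ω₂.ContainedIn (C : Set V)

/-- The largest `m` for which the two ends lie in the same component of the complement of the ball
of radius `m - 1` around the root `o`. In a locally finite connected graph distinct ends are
separated by some ball, so that the value is `⊤` exactly when the two ends are equal. -/
def GraphEnd.confluence {G : SimpleGraph V} (o : V) (ω₁ ω₂ : GraphEnd G) : ℕ∞ :=
  ⨆ (m : ℕ) (_ : GraphEnd.SameComponent o m ω₁ ω₂), (m : ℕ∞)

open Classical in
/-- The metric on the space of ends with exponent `α`: the distance of two distinct ends is `α`
to the power of their confluence, and the distance of an end to itself is `0`. -/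
def GraphEnd.endDist {G : SimpleGraph V} (o : V) (α : ℝ) (ω₁ ω₂ : GraphEnd G) : ℝ :=
  if GraphEnd.confluence o ω₁ ω₂ = ⊤ then 0
  else α ^ (GraphEnd.confluence o ω₁ ω₂).toNat

end GraphEnds

/-! ### Hausdorff dimension, through countable covers by closed balls -/

section Hausdorff

variable {X : Type*}

/-- `T` lists the centres and radii of a finite or countable family of closed balls that covers
`A`, with centres in `A` and positive radii smaller than `ε`. -/
def IsBallCover (d : X → X → ℝ) (A : Set X) (ε : ℝ) (T : Set (X × ℝ)) : Prop :=
  T.Countable ∧ (∀ p ∈ T, p.1 ∈ A ∧ 0 < p.2 ∧ p.2 < ε) ∧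
    A ⊆ ⋃ p ∈ T, {x | d p.1 x ≤ p.2}

/-- The `δ`-dimensional Hausdorff measure of `A`. The infimum over covers increases as `ε`
decreases, so the supremum over `ε > 0` is the limit for `ε → 0`. -/
def ballHausdorffMeasure (d : X → X → ℝ) (δ : ℝ≥0) (A : Set X) : ℝ≥0∞ :=
  ⨆ (ε : ℝ) (_ : 0 < ε), ⨅ (T : Set (X × ℝ)) (_ : IsBallCover d A ε T),
    ∑' p : T, ENNReal.ofReal p.1.2 ^ (δ : ℝ)

/-- The Hausdorff dimension of `A`: the infimum of all `δ ≥ 0` for which the `δ`-dimensional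
Hausdorff measure of `A` is zero. -/
def ballHausdorffDim (d : X → X → ℝ) (A : Set X) : ℝ≥0∞ :=
  ⨅ (δ : ℝ≥0) (_ : ballHausdorffMeasure d δ A = 0), (δ : ℝ≥0∞)

end Hausdorff

/-! ### Free products and their ends -/

section FreeProduct

open Monoid

variable {ι : Type*} {Γ : ι → Type*} [∀ i, Group (Γ i)]

/-- The Cayley graph of the free product of the groups `Γ i` with respect to the union of the
generating sets `S i` of the factors. -/
def freeProductGraph (S : ∀ i, Set (Γ i)) : SimpleGraph (CoprodI Γ) :=
  SimpleGraph.mulCayley (⋃ i, (CoprodI.of : Γ i →* CoprodI Γ) '' S i)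

/-- The embedding of the Cayley graph of the factor `Γ i` onto the copy of it that is attached at
the vertex `x` of the free product. -/
def factorCopy (S : ∀ i, Set (Γ i)) (i : ι) (x : CoprodI Γ) :
    SimpleGraph.mulCayley (S i) →g freeProductGraph S where
  toFun y := x * CoprodI.of y
  map_rel' {a b} h := by
    rw [SimpleGraph.mulCayley_adj'] at h
    rw [freeProductGraph, SimpleGraph.mulCayley_adj']
    obtain ⟨hne, g, hg, h⟩ := h
    refine ⟨fun e => hne (CoprodI.of_injective i (mul_left_cancel e)), CoprodI.of g,
      Set.mem_iUnion.2 ⟨i, g, hg, rfl⟩, ?_⟩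
    rcases h with h | h
    · exact Or.inl (by rw [mul_assoc, ← map_mul, h])
    · exact Or.inr (by rw [mul_assoc, ← map_mul, h])

theorem factorCopy_injective (S : ∀ i, Set (Γ i)) (i : ι) (x : CoprodI Γ) :
    Function.Injective (factorCopy S i x) :=
  fun _ _ h => CoprodI.of_injective i (mul_left_cancel h)

/-- The ends `x ω` of the free product, where `x` is an element of the free product and `ω` is an
end of the Cayley graph of the factor `Γ i`. -/
def factorEnds (S : ∀ i, Set (Γ i)) (i : ι) : Set (GraphEnd (freeProductGraph S)) :=
  {ω | ∃ (x : CoprodI Γ) (ξ : GraphEnd (SimpleGraph.mulCayley (S i))),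
    ω = ξ.map (factorCopy S i x) (factorCopy_injective S i x)}

/-- An infinite word: a sequence of nontrivial elements of the factors, no two consecutive ones of
which come from the same factor. -/
def IsInfiniteWord (w : ℕ → Σ i, Γ i) : Prop :=
  ∀ n, (w n).2 ≠ 1 ∧ (w n).1 ≠ (w (n + 1)).1

/-- The product of the first `n` letters of an infinite word. -/
def wordPrefix (w : ℕ → Σ i, Γ i) (n : ℕ) : CoprodI Γ :=
  ((List.range n).map fun k => CoprodI.of (w k).2).prod

/-- The ends that are described by infinite words: those represented by a ray that passes through
all finite prefixes of an infinite word. (Two rays through all prefixes of the same word share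
infinitely many vertices, so they represent the same end.) -/
def infiniteWordEnds (S : ∀ i, Set (Γ i)) : Set (GraphEnd (freeProductGraph S)) :=
  {ω | ∃ w : ℕ → Σ i, Γ i, IsInfiniteWord w ∧
    ∃ ρ : GraphRay (freeProductGraph S), ρ.toEnd = ω ∧ ∀ n, wordPrefix w n ∈ Set.range ρ.vertex}

/-- The Hausdorff dimension of a set of ends of the free product, with respect to the metric on
ends with exponent `α` and root the identity. -/
def endHausdorffDim (S : ∀ i, Set (Γ i)) (α : ℝ) (A : Set (GraphEnd (freeProductGraph S))) :
    ℝ≥0∞ :=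
  ballHausdorffDim (GraphEnd.endDist 1 α) A

end FreeProduct

end

/-! Both dimensions are compared with the exponential growth rate of $\Gamma_i$. Let $s_m$ be the
size of the sphere of radius $m$ in $\mathcal X_i$. If $\Gamma_i$ is infinite, $s_m$ is positive and
submultiplicative, so Fekete's lemma yields an exponent $c$ with $s_m\alpha^{cm}\ge1$ for all $m$
and $s_m\alpha^{\delta m}\to0$ for every $\delta>c$ (`exists_critical_exponent`). If $\Gamma_i$ is
finite, $c=0$ serves.

Upper bound: the ends of one copy $x\mathcal X_i$ are covered by at most $s_{k+l(x)}$ balls of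
radius $\alpha^k$, and there are countably many copies, so $\mathcal H_\delta(\Omega_i)=0$ for
$\delta>c$ (`ballHausdorffMeasure_factorEnds_eq_zero`).

Lower bound: take infinite words that alternate between a finite set $T$ of letters of $\Gamma_i$
and a finite set $Y$ of letters of other factors. If
$\sum_T\alpha^{\delta|x|}\cdot\sum_Y\alpha^{\delta|y|}\ge1$, a Bernoulli measure on these words
gives a ball of radius $\varepsilon$ mass $O(\varepsilon^\delta)$, so $\mathcal
H_\delta(\Omega_\infty)>0$ (`ballHausdorffMeasure_infiniteWordEnds_ne_zero`).

The strict gap arises because the growth series of an infinite $\Gamma_i$ diverges at the exponent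
$c$ itself: a finite $T$ makes the product exceed 1 there (`exists_exponent_one_lt_sum_mul_sum`),
and by continuity it still does at some $\delta>c$. For finite $\Gamma_i$ the product at $c=0$ is
$|T||Y|$, which can be made 2 outside the excluded case. -/

noncomputable section

/-! ### Ends and the components left by removing finite sets. -/

section EndComponents

open Filter SimpleGraph

variable {V W : Type*} {G : SimpleGraph V} {H : SimpleGraph W}

theorem GraphRay.Equivalent.symm {ρ σ : GraphRay G} (h : ρ.Equivalent σ) : σ.Equivalent ρ := by
  obtain ⟨τ, h₁, h₂⟩ := h
  exact ⟨τ, h₂, h₁⟩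

theorem GraphRay.exists_componentCompl (ρ : GraphRay G) {K : Set V} (hK : K.Finite) :
    ∃ C : G.ComponentCompl K, ∀ᶠ n in atTop, ρ.vertex n ∈ C := by
  have h : ∀ᶠ n in atTop, ρ.vertex n ∉ K := by
    rw [← Nat.cofinite_eq_atTop, eventually_cofinite]
    simp only [not_not]
    exact hK.preimage ρ.injective.injOn
  obtain ⟨N, hN⟩ := eventually_atTop.1 h
  refine ⟨G.componentComplMk (hN N le_rfl), eventually_atTop.2 ⟨N, fun n hn => ?_⟩⟩
  induction n, hn using Nat.le_induction with
  | base => exact componentComplMk_mem G _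
  | succ n hn ih => exact ComponentCompl.mem_of_adj _ _ ih (hN _ (by lia)) (ρ.adj n)

theorem GraphRay.componentCompl_eq_of_infinite_inter {ρ σ : GraphRay G} {K : Set V}
    (h : (Set.range ρ.vertex ∩ Set.range σ.vertex).Infinite) {C D : G.ComponentCompl K}
    (hC : ∀ᶠ n in atTop, ρ.vertex n ∈ C) (hD : ∀ᶠ n in atTop, σ.vertex n ∈ D) : C = D := by
  rw [← Nat.cofinite_eq_atTop, eventually_cofinite] at hC hD
  obtain ⟨v, ⟨⟨a, ha⟩, ⟨b, hb⟩⟩, hv⟩ :=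
    (h.sdiff ((hC.image ρ.vertex).union (hD.image σ.vertex))).nonempty
  have hvC : v ∈ C := by
    by_contra hc
    exact hv (Or.inl ⟨a, by simpa [ha] using hc, ha⟩)
  have hvD : v ∈ D := by
    by_contra hc
    exact hv (Or.inr ⟨b, by simpa [hb] using hc, hb⟩)
  by_contra hne
  exact Set.disjoint_left.1 (ComponentCompl.pairwise_disjoint hne) hvC hvD

theorem GraphRay.Equivalent.eventually_mem {ρ σ : GraphRay G} (h : ρ.Equivalent σ) {K : Set V}
    (hK : K.Finite) {C : G.ComponentCompl K} (hC : ∀ᶠ n in atTop, ρ.vertex n ∈ C) :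
    ∀ᶠ n in atTop, σ.vertex n ∈ C := by
  obtain ⟨τ, h₁, h₂⟩ := h
  obtain ⟨D, hD⟩ := τ.exists_componentCompl hK
  obtain ⟨E, hE⟩ := σ.exists_componentCompl hK
  rw [← GraphRay.componentCompl_eq_of_infinite_inter h₁ hD hC,
    GraphRay.componentCompl_eq_of_infinite_inter h₂ hD hE]
  exact hE

theorem GraphEnd.exists_toEnd_eq (ω : GraphEnd G) : ∃ ρ : GraphRay G, ρ.toEnd = ω :=
  Quot.exists_rep ω

theorem GraphEnd.ContainedIn.eventually {ρ : GraphRay G} {A : Set V}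
    (h : ρ.toEnd.ContainedIn A) : ∀ᶠ n in atTop, ρ.vertex n ∈ A := by
  rw [← Nat.cofinite_eq_atTop, eventually_cofinite]
  exact h ρ rfl

theorem GraphRay.toEnd_containedIn (ρ : GraphRay G) {K : Set V} (hK : K.Finite)
    {C : G.ComponentCompl K} (hC : ∀ᶠ n in atTop, ρ.vertex n ∈ C) :
    ρ.toEnd.ContainedIn (C : Set V) := by
  intro σ hσ
  -- Equal ends are a priori joined only by a chain of equivalences, so the property is lifted to
  -- the quotient instead of being transferred along a single equivalence.
  let P : GraphEnd G → Prop := Quot.lift (fun τ => ∀ᶠ n in atTop, τ.vertex n ∈ C)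
    fun τ τ' h => propext ⟨h.eventually_mem hK, h.symm.eventually_mem hK⟩
  have hP : P σ.toEnd = P ρ.toEnd := congrArg P hσ
  have h : ∀ᶠ n in atTop, σ.vertex n ∈ C := hP.mpr hC
  rwa [← Nat.cofinite_eq_atTop, eventually_cofinite] at h

theorem GraphEnd.ContainedIn.componentCompl_eq {ω : GraphEnd G} {K : Set V}
    {C D : G.ComponentCompl K} (hC : ω.ContainedIn (C : Set V)) (hD : ω.ContainedIn (D : Set V)) :
    C = D := by
  obtain ⟨ρ, rfl⟩ := ω.exists_toEnd_eq
  obtain ⟨n, hn⟩ := (hC.eventually.and hD.eventually).exists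
  by_contra hne
  exact Set.disjoint_left.1 (ComponentCompl.pairwise_disjoint hne) hn.1 hn.2

theorem GraphEnd.SameComponent.trans_left {o : V} {m : ℕ} {ω ω₁ ω₂ : GraphEnd G}
    (h₁ : GraphEnd.SameComponent o m ω ω₁) (h₂ : GraphEnd.SameComponent o m ω ω₂) :
    GraphEnd.SameComponent o m ω₁ ω₂ := by
  obtain ⟨C, hC, hC₁⟩ := h₁
  obtain ⟨D, hD, hD₂⟩ := h₂
  obtain rfl := hC.componentCompl_eq hD
  exact ⟨C, hC₁, hD₂⟩

theorem GraphEnd.ContainedIn.mono {ω : GraphEnd G} {A B : Set V} (h : ω.ContainedIn A)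
    (hAB : A ⊆ B) : ω.ContainedIn B :=
  fun ρ hρ => (h ρ hρ).subset fun _ hn hA => hn (hAB hA)

theorem GraphEnd.SameComponent.mono {o : V} {m n : ℕ} (hmn : m ≤ n) {ω₁ ω₂ : GraphEnd G}
    (h : GraphEnd.SameComponent o n ω₁ ω₂) : GraphEnd.SameComponent o m ω₁ ω₂ := by
  obtain ⟨C, h₁, h₂⟩ := h
  have hK : {v | G.dist o v < m} ⊆ {v | G.dist o v < n} := fun v hv => lt_of_lt_of_le hv hmn
  exact ⟨C.hom hK, h₁.mono (C.subset_hom hK), h₂.mono (C.subset_hom hK)⟩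

theorem GraphEnd.endDist_le_pow {o : V} {α : ℝ} (hα0 : 0 < α) (hα1 : α < 1) {m : ℕ}
    {ω₁ ω₂ : GraphEnd G} (h : GraphEnd.SameComponent o m ω₁ ω₂) :
    GraphEnd.endDist o α ω₁ ω₂ ≤ α ^ m := by
  unfold GraphEnd.endDist
  split_ifs with ht
  · positivity
  · have hm : (m : ℕ∞) ≤ GraphEnd.confluence o ω₁ ω₂ :=
      le_iSup₂ (f := fun (m : ℕ) (_ : GraphEnd.SameComponent o m ω₁ ω₂) => (m : ℕ∞)) m h
    obtain ⟨c, hc⟩ := ENat.ne_top_iff_exists.1 ht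
    rw [← hc] at hm ⊢
    exact pow_le_pow_of_le_one hα0.le hα1.le (by simpa using hm)

/-- The strict inequality gains one layer: the confluence is an integer above `m`, so the vertices
at distance exactly `m` may be removed too. -/
theorem GraphEnd.sameComponent_of_endDist_lt {o : V} {α : ℝ} (hα0 : 0 < α) (hα1 : α < 1) {m : ℕ}
    {ω₁ ω₂ : GraphEnd G} (h : GraphEnd.endDist o α ω₁ ω₂ < α ^ m) :
    GraphEnd.SameComponent o (m + 1) ω₁ ω₂ := by
  have hm : (m : ℕ∞) < GraphEnd.confluence o ω₁ ω₂ := by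
    unfold GraphEnd.endDist at h
    split_ifs at h with ht
    · rw [ht]; exact ENat.natCast_lt_top m
    · obtain ⟨c, hc⟩ := ENat.ne_top_iff_exists.1 ht
      rw [← hc] at h ⊢
      rw [pow_lt_pow_iff_right_of_lt_one₀ hα0 hα1] at h
      simpa using h
  obtain ⟨n, hn⟩ := lt_iSup_iff.1 hm
  obtain ⟨hn, hmn⟩ := lt_iSup_iff.1 hn
  exact GraphEnd.SameComponent.mono (by exact_mod_cast hmn) hn

theorem GraphRay.sameComponent_map {f : G →g H} (hf : Function.Injective f) {K : Set V} {o : W}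
    {m : ℕ} (hfin : {v | H.dist o v < m}.Finite) (hK : ∀ v, v ∉ K → ¬ H.dist o (f v) < m)
    {C : G.ComponentCompl K} {ρ σ : GraphRay G} (hρ : ∀ᶠ n in atTop, ρ.vertex n ∈ C)
    (hσ : ∀ᶠ n in atTop, σ.vertex n ∈ C) :
    GraphEnd.SameComponent o m (ρ.map f hf).toEnd (σ.map f hf).toEnd := by
  let g : G.induce Kᶜ →g H.induce {v | H.dist o v < m}ᶜ := induceHom f fun v hv => hK v hv
  have hg : ∀ v ∈ C, f v ∈ (C.map g : H.ComponentCompl {v | H.dist o v < m}) := by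
    rintro v ⟨hv, rfl⟩
    exact ⟨hK v hv, rfl⟩
  exact ⟨C.map g, GraphRay.toEnd_containedIn _ hfin (hρ.mono fun n hn => hg _ hn),
    GraphRay.toEnd_containedIn _ hfin (hσ.mono fun n hn => hg _ hn)⟩

end EndComponents

/-! ### Geodesics, spheres and rays in connected graphs. -/

section GraphDist

open SimpleGraph

variable {V W : Type*} {G : SimpleGraph V} {H : SimpleGraph W}

theorem SimpleGraph.Connected.dist_map_le (hG : G.Connected) (f : G →g H) (u v : V) :
    H.dist (f u) (f v) ≤ G.dist u v := by
  obtain ⟨p, hp⟩ := hG.exists_walk_length_eq_dist u v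
  rw [← hp, ← Walk.length_map f p]
  exact dist_le _

theorem SimpleGraph.Connected.exists_adj_dist_eq (hG : G.Connected) {o v : V} {n : ℕ}
    (h : G.dist o v = n + 1) : ∃ u, G.Adj u v ∧ G.dist o u = n := by
  obtain ⟨p, hp⟩ := hG.exists_walk_length_eq_dist v o
  rw [dist_comm, h] at hp
  cases p with
  | nil => simp at hp
  | @cons _ u _ hadj q =>
    refine ⟨u, hadj.symm, ?_⟩
    have h₁ : G.dist o u ≤ n := by
      rw [dist_comm]
      refine (dist_le q).trans ?_
      simpa using hp.le
    have h₂ := hG.dist_triangle (u := o) (v := u) (w := v)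
    have h₃ : G.dist u v = 1 := dist_eq_one_iff_adj.2 hadj.symm
    lia

theorem SimpleGraph.Connected.exists_dist_eq_dist_eq (hG : G.Connected) {o : V} {m n : ℕ} :
    ∀ {v : V}, G.dist o v = m + n → ∃ u, G.dist o u = m ∧ G.dist u v = n := by
  induction n with
  | zero => exact fun {v} h => ⟨v, h, dist_self⟩
  | succ n ih =>
    intro v h
    obtain ⟨u, hadj, hu⟩ := hG.exists_adj_dist_eq (n := m + n) h
    obtain ⟨z, hz, hzu⟩ := ih hu
    refine ⟨z, hz, ?_⟩
    have h₁ := hG.dist_triangle (u := z) (v := u) (w := v)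
    have h₂ := hG.dist_triangle (u := o) (v := z) (w := v)
    have h₃ : G.dist u v = 1 := dist_eq_one_iff_adj.2 hadj
    lia

/-- A geodesic towards `o` stays in its component until it reaches distance `m`. Hence the
components are at most as many as the points of the sphere. -/
theorem SimpleGraph.Connected.exists_dist_eq_mem_componentCompl (hG : G.Connected) {o : V} {m : ℕ}
    (C : G.ComponentCompl {v | G.dist o v < m}) : ∃ z ∈ C, G.dist o z = m := by
  obtain ⟨v, hv⟩ := C.nonempty
  replace hv : v ∈ C := hv
  have hm : m ≤ G.dist o v := not_lt.1 fun h => ComponentCompl.notMem_of_mem hv h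
  obtain ⟨k, hk⟩ := Nat.exists_eq_add_of_le hm
  clear hm
  induction k generalizing v with
  | zero => exact ⟨v, hv, hk⟩
  | succ k ih =>
    obtain ⟨u, hadj, hu⟩ := hG.exists_adj_dist_eq (n := m + k) hk
    refine ih u (ComponentCompl.mem_of_adj v u hv ?_ hadj.symm) hu
    simp [hu]

theorem SimpleGraph.Connected.finite_dist_lt (hG : G.Connected)
    (hfin : ∀ v, (G.neighborSet v).Finite) (o : V) (m : ℕ) : {v | G.dist o v < m}.Finite := by
  induction m with
  | zero => simp
  | succ m ih =>
    refine ((Set.finite_singleton o).union (ih.biUnion fun u _ => hfin u)).subset fun v hv => ?_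
    obtain h | hn := Nat.eq_zero_or_eq_succ_pred (G.dist o v)
    · exact Or.inl (hG.dist_eq_zero_iff.1 h).symm
    · obtain ⟨u, hadj, hu⟩ := hG.exists_adj_dist_eq hn
      refine Or.inr (Set.mem_biUnion (x := u) ?_ hadj)
      simp only [Set.mem_ofPred_eq] at hv ⊢
      lia

/-- Additivity of the distances makes the concatenated geodesics `w n` geodesic again, so no vertex
repeats. -/
theorem SimpleGraph.Connected.exists_graphRay (hG : G.Connected) (p : ℕ → V)
    (hne : ∀ n, p n ≠ p (n + 1))
    (hp : ∀ n, G.dist (p 0) (p (n + 1)) = G.dist (p 0) (p n) + G.dist (p n) (p (n + 1))) :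
    ∃ ρ : GraphRay G, ∀ n, p n ∈ Set.range ρ.vertex := by
  choose q hq using fun n => hG.exists_walk_length_eq_dist (p n) (p (n + 1))
  let w : ∀ n, G.Walk (p 0) (p n) := fun n => Nat.rec Walk.nil (fun n w => w.append (q n)) n
  have hw : ∀ n, w (n + 1) = (w n).append (q n) := fun n => rfl
  have hlen : ∀ n, (w n).length = G.dist (p 0) (p n) := by
    intro n
    induction n with
    | zero => simp [w]
    | succ n ih => rw [hw, Walk.length_append, ih, hq, hp]
  have hle : ∀ n, n ≤ (w n).length := by
    intro n
    induction n with
    | zero => simp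
    | succ n ih =>
      rw [hw, Walk.length_append, hq]
      have := hG.pos_dist_of_ne (hne n)
      lia
  have hget : ∀ m n k, m ≤ n → k ≤ (w m).length → (w n).getVert k = (w m).getVert k := by
    intro m n k hmn hk
    have hk' : ∀ n, m ≤ n → k ≤ (w n).length ∧ (w n).getVert k = (w m).getVert k := by
      intro n hmn
      induction n, hmn using Nat.le_induction with
      | base => exact ⟨hk, rfl⟩
      | succ n _ ih =>
        rw [hw, Walk.length_append, Walk.getVert_append, ← ih.2]
        refine ⟨by lia, ?_⟩
        split_ifs with h
        · rfl
        · have : k = (w n).length := by lia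
          simp [this]
    exact (hk' n hmn).2
  -- Since `w k` has length at least `k`, its `k`-th vertex is not the default value of `getVert`
  -- and is kept by all later walks.
  have hvert : ∀ n k, k ≤ n → (w k).getVert k = (w n).getVert k := fun n k hk =>
    (hget k n k hk (hle k)).symm
  refine ⟨⟨fun k => (w k).getVert k, fun k => ?_, fun a b hab => ?_⟩, fun n => ?_⟩
  · rw [hvert (k + 1) k (by lia)]
    exact (w (k + 1)).adj_getVert_succ (by have := hle (k + 1); lia)
  · have h := hab
    simp only [hvert (max a b) a (le_max_left _ _), hvert (max a b) b (le_max_right _ _)] at h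
    have hpath := (w (max a b)).isPath_of_length_eq_dist (hlen _)
    have := hle (max a b)
    exact hpath.getVert_injOn (by simp only [Set.mem_ofPred_eq]; lia)
      (by simp only [Set.mem_ofPred_eq]; lia) h
  · refine ⟨(w n).length, ?_⟩
    change (w (w n).length).getVert (w n).length = p n
    rw [hget n _ _ (hle n) le_rfl, Walk.getVert_length]

end GraphDist

/-! ### Metric and growth of Cayley graphs. -/

section CayleyGraph

open SimpleGraph

variable {G : Type*} [Group G] {S : Set G}

/-- Left multiplication as an endomorphism of the Cayley graph. -/
def mulCayleyLeftMul (S : Set G) (g : G) : mulCayley S →g mulCayley S where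
  toFun x := g * x
  map_rel' h := mulCayley_adj_mul_iff_right.2 h

theorem mulCayley_connected (h : Subgroup.closure S = ⊤) : (mulCayley S).Connected := by
  have hmul : ∀ {a b : G} (g : G), (mulCayley S).Reachable a b →
      (mulCayley S).Reachable (g * a) (g * b) := fun g h => h.map (mulCayleyLeftMul S g)
  have hone : ∀ g : G, (mulCayley S).Reachable 1 g := by
    intro g
    have hg : g ∈ Subgroup.closure S := h ▸ Subgroup.mem_top g
    induction hg using Subgroup.closure_induction with
    | mem x hx =>
      by_cases hx1 : x = 1
      · rw [hx1]
      · exact Adj.reachable ((mulCayley_adj' S 1 x).2 ⟨Ne.symm hx1, x, hx, by simp⟩)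
    | one => rfl
    | mul a b _ _ ha hb => exact ha.trans (by simpa using hmul a hb)
    | inv a _ ha => exact (by simpa using hmul a⁻¹ ha : (mulCayley S).Reachable a⁻¹ 1).symm
  exact ⟨fun a b => (hone a).symm.trans (hone b)⟩

theorem mulCayley_dist_mul_left (h : Subgroup.closure S = ⊤) (g a b : G) :
    (mulCayley S).dist (g * a) (g * b) = (mulCayley S).dist a b := by
  have hc := mulCayley_connected h
  refine le_antisymm (hc.dist_map_le (mulCayleyLeftMul S g) a b) ?_
  simpa [mulCayleyLeftMul] using hc.dist_map_le (mulCayleyLeftMul S g⁻¹) (g * a) (g * b)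

theorem mulCayley_dist_one_inv (h : Subgroup.closure S = ⊤) (g : G) :
    (mulCayley S).dist 1 g⁻¹ = (mulCayley S).dist 1 g := by
  rw [← mulCayley_dist_mul_left h g, dist_comm]
  simp

theorem mulCayley_dist_one_mul_le (h : Subgroup.closure S = ⊤) (a b : G) :
    (mulCayley S).dist 1 (a * b) ≤ (mulCayley S).dist 1 a + (mulCayley S).dist 1 b := by
  refine ((mulCayley_connected h).dist_triangle (v := a)).trans ?_
  rw [← mulCayley_dist_mul_left h a 1 b, mul_one]

theorem mulCayley_dist_one_le_one {s : G} (hs : s ∈ S) : (mulCayley S).dist 1 s ≤ 1 := by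
  by_cases h : s = 1
  · simp [h]
  · exact (dist_eq_one_iff_adj.2 ((mulCayley_adj' S 1 s).2 ⟨Ne.symm h, s, hs, by simp⟩)).le

theorem mulCayley_finite_dist_lt (hS : S.Finite) (h : Subgroup.closure S = ⊤) (m : ℕ) :
    {g | (mulCayley S).dist 1 g < m}.Finite := by
  refine (mulCayley_connected h).finite_dist_lt (fun v => ?_) 1 m
  refine ((hS.image (v * ·)).union (hS.image (v * ·⁻¹))).subset fun u hu => ?_
  obtain ⟨-, s, hs, rfl | rfl⟩ := (mulCayley_adj' S v u).1 hu
  · exact Or.inl ⟨s, hs, rfl⟩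
  · exact Or.inr ⟨s, hs, by simp⟩

theorem mulCayley_finite_dist_eq (hS : S.Finite) (h : Subgroup.closure S = ⊤) (m : ℕ) :
    {g | (mulCayley S).dist 1 g = m}.Finite :=
  (mulCayley_finite_dist_lt hS h (m + 1)).subset fun _ hg => Nat.lt_succ_of_le hg.le

/-- Cutting a geodesic from `1` at distance `m` factors each element of the larger sphere. -/
theorem mulCayley_ncard_dist_eq_add_le (hS : S.Finite) (h : Subgroup.closure S = ⊤) (m n : ℕ) :
    {g | (mulCayley S).dist 1 g = m + n}.ncard ≤
      {g | (mulCayley S).dist 1 g = m}.ncard * {g | (mulCayley S).dist 1 g = n}.ncard := by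
  rw [← Set.ncard_prod]
  refine (Set.ncard_le_ncard (t := (fun p : G × G => p.1 * p.2) ''
    ({g | (mulCayley S).dist 1 g = m} ×ˢ {g | (mulCayley S).dist 1 g = n})) ?_ ?_).trans
    (Set.ncard_image_le ?_)
  · intro g hg
    obtain ⟨u, hu, hug⟩ := (mulCayley_connected h).exists_dist_eq_dist_eq hg
    refine ⟨(u, u⁻¹ * g), ⟨hu, ?_⟩, by simp⟩
    simp only [Set.mem_ofPred_eq]
    rw [← mulCayley_dist_mul_left h u]
    simpa using hug
  all_goals have := (mulCayley_finite_dist_eq hS h m).prod (mulCayley_finite_dist_eq hS h n)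
  · exact this.image _
  · exact this

theorem mulCayley_exists_dist_eq [Infinite G] (hS : S.Finite) (h : Subgroup.closure S = ⊤)
    (m : ℕ) : ∃ g, (mulCayley S).dist 1 g = m := by
  obtain ⟨g, hg⟩ := (mulCayley_finite_dist_lt hS h m).exists_notMem
  obtain ⟨k, hk⟩ := Nat.exists_eq_add_of_le (not_lt.1 hg)
  obtain ⟨u, hu, -⟩ := (mulCayley_connected h).exists_dist_eq_dist_eq hk
  exact ⟨u, hu⟩

end CayleyGraph

/-! ### Length in the free product against the lengths of letters. -/

section WordLength

open Monoid SimpleGraph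

variable {ι : Type*} {Γ : ι → Type*} [∀ i, Group (Γ i)] {S : ∀ i, Set (Γ i)}

theorem closure_iUnion_of_image_eq_top (hgen : ∀ i, Subgroup.closure (S i) = ⊤) :
    Subgroup.closure (⋃ i, (CoprodI.of : Γ i →* CoprodI Γ) '' S i) = ⊤ := by
  refine eq_top_iff.2 fun g _ => ?_
  induction g using CoprodI.induction_on with
  | one => exact one_mem _
  | of i m =>
    have hm : (CoprodI.of m : CoprodI Γ) ∈ (Subgroup.closure (S i)).map CoprodI.of :=
      ⟨m, by rw [hgen i]; trivial, rfl⟩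
    rw [MonoidHom.map_closure] at hm
    exact Subgroup.closure_mono (Set.subset_iUnion _ i) hm
  | mul a b ha hb => exact mul_mem (ha trivial) (hb trivial)

theorem freeProductGraph_connected (hgen : ∀ i, Subgroup.closure (S i) = ⊤) :
    (freeProductGraph S).Connected :=
  mulCayley_connected (closure_iUnion_of_image_eq_top hgen)

theorem freeProductGraph_finite_dist_lt [Finite ι] (hfin : ∀ i, (S i).Finite)
    (hgen : ∀ i, Subgroup.closure (S i) = ⊤) (m : ℕ) :
    {g | (freeProductGraph S).dist 1 g < m}.Finite :=
  mulCayley_finite_dist_lt (Set.finite_iUnion fun i => (hfin i).image _)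
    (closure_iUnion_of_image_eq_top hgen) m

/-- The distance of a letter to the identity in the Cayley graph of its factor. -/
def letterLength (S : ∀ i, Set (Γ i)) (l : Σ i, Γ i) : ℕ :=
  (mulCayley (S l.1)).dist 1 l.2

/-- The sum of the lengths of the letters of a reduced word. -/
def wordLength (S : ∀ i, Set (Γ i)) (w : CoprodI.Word Γ) : ℕ :=
  (w.toList.map (letterLength S)).sum

theorem freeProductGraph_dist_mul_of_le (hgen : ∀ i, Subgroup.closure (S i) = ⊤) {i : ι}
    (x : CoprodI Γ) (y : Γ i) :
    (freeProductGraph S).dist x (x * CoprodI.of y) ≤ letterLength S ⟨i, y⟩ := by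
  simpa [factorCopy, letterLength] using (mulCayley_connected (hgen i)).dist_map_le (factorCopy S i x) 1 y

theorem letterLength_inv (hgen : ∀ i, Subgroup.closure (S i) = ⊤) {i : ι} (y : Γ i) :
    letterLength S ⟨i, y⁻¹⟩ = letterLength S ⟨i, y⟩ :=
  mulCayley_dist_one_inv (hgen i) y

theorem letterLength_pos (hgen : ∀ i, Subgroup.closure (S i) = ⊤) {l : Σ i, Γ i} (h : l.2 ≠ 1) :
    0 < letterLength S l :=
  (mulCayley_connected (hgen l.1)).pos_dist_of_ne h.symm

open Classical in
theorem wordLength_rcons {i : ι} (p : CoprodI.Word.Pair Γ i) :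
    wordLength S (CoprodI.Word.rcons p) = letterLength S ⟨i, p.head⟩ + wordLength S p.tail := by
  unfold CoprodI.Word.rcons
  split_ifs with h
  · simp [h, letterLength]
  · simp [wordLength]

open Classical in
theorem wordLength_of_smul_le (hgen : ∀ i, Subgroup.closure (S i) = ⊤) {i : ι} (s : Γ i)
    (w : CoprodI.Word Γ) :
    wordLength S (CoprodI.of s • w) ≤ letterLength S ⟨i, s⟩ + wordLength S w := by
  obtain ⟨p, rfl⟩ := (CoprodI.Word.equivPair i).symm.surjective w
  rw [CoprodI.Word.of_smul_def, wordLength_rcons, CoprodI.Word.equivPair_symm, wordLength_rcons,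
    ← CoprodI.Word.equivPair_symm, Equiv.apply_symm_apply, ← add_assoc]
  exact Nat.add_le_add_right (mulCayley_dist_one_mul_le (hgen i) _ _) _

theorem exists_of_mul_inv_of_adj {g h : CoprodI Γ} (hadj : (freeProductGraph S).Adj g h) :
    ∃ (i : ι) (s : Γ i), h⁻¹ = CoprodI.of s * g⁻¹ ∧ (s ∈ S i ∨ s⁻¹ ∈ S i) := by
  rw [freeProductGraph, mulCayley_adj'] at hadj
  obtain ⟨-, t, ht, h | h⟩ := hadj
  · obtain ⟨i, s, hs, rfl⟩ := Set.mem_iUnion.1 ht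
    exact ⟨i, s⁻¹, by simp [← h], Or.inr (by simpa)⟩
  · obtain ⟨i, s, hs, rfl⟩ := Set.mem_iUnion.1 ht
    exact ⟨i, s, by simp [h], Or.inl hs⟩

open Classical in
-- Edges multiply on the right, whereas letters act on reduced words from the left. Passing to
-- inverses reconciles the two: an edge changes the word of `g⁻¹` by one generator at its head.
theorem wordLength_inv_smul_empty_le (hgen : ∀ i, Subgroup.closure (S i) = ⊤) (g : CoprodI Γ) :
    wordLength S (g⁻¹ • CoprodI.Word.empty) ≤ (freeProductGraph S).dist 1 g := by
  have key : ∀ {a b : CoprodI Γ} (p : (freeProductGraph S).Walk a b),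
      wordLength S (b⁻¹ • CoprodI.Word.empty) ≤
        wordLength S (a⁻¹ • CoprodI.Word.empty) + p.length := by
    intro a b p
    induction p with
    | nil => simp
    | @cons a b c hadj p ih =>
      obtain ⟨i, s, hs, hS⟩ := exists_of_mul_inv_of_adj hadj
      have h₁ : letterLength S ⟨i, s⟩ ≤ 1 := by
        obtain hS | hS := hS
        · exact mulCayley_dist_one_le_one hS
        · rw [← letterLength_inv hgen]
          exact mulCayley_dist_one_le_one hS
      have h₂ := wordLength_of_smul_le hgen s (a⁻¹ • CoprodI.Word.empty)
      rw [smul_smul, ← hs] at h₂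
      rw [Walk.length_cons]
      lia
  obtain ⟨p, hp⟩ := (freeProductGraph_connected hgen).exists_walk_length_eq_dist 1 g
  have := key p
  rw [← hp]
  simpa [wordLength, CoprodI.Word.empty] using this

theorem letterLength_le_dist_of (hgen : ∀ i, Subgroup.closure (S i) = ⊤) {i : ι} (y : Γ i) :
    letterLength S ⟨i, y⟩ ≤ (freeProductGraph S).dist 1 (CoprodI.of y) := by
  classical
  refine le_trans ?_ (wordLength_inv_smul_empty_le hgen _)
  rw [← map_inv, CoprodI.Word.of_smul_def, wordLength_rcons,
    CoprodI.Word.equivPair_eq_of_fstIdx_ne (by simp [CoprodI.Word.fstIdx]), mul_one,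
    letterLength_inv hgen]
  exact Nat.le_add_right _ _

end WordLength

/-! ### Rays along infinite words, and prefixes as cut vertices. -/

section InfiniteWords

open Monoid SimpleGraph

variable {ι : Type*} {Γ : ι → Type*} [∀ i, Group (Γ i)] {S : ∀ i, Set (Γ i)}

theorem wordPrefix_succ (w : ℕ → Σ i, Γ i) (n : ℕ) :
    wordPrefix w (n + 1) = wordPrefix w n * CoprodI.of (w n).2 := by
  simp [wordPrefix, List.range_succ]

open Classical in
theorem toList_inv_wordPrefix_smul_empty {w : ℕ → Σ i, Γ i} (hw : IsInfiniteWord w) (n : ℕ) :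
    ((wordPrefix w n)⁻¹ • (CoprodI.Word.empty : CoprodI.Word Γ)).toList =
      (List.range n).reverse.map fun k => ⟨(w k).1, (w k).2⁻¹⟩ := by
  induction n with
  | zero => simp [wordPrefix]
  | succ n ih =>
    have hidx : ((wordPrefix w n)⁻¹ • (CoprodI.Word.empty : CoprodI.Word Γ)).fstIdx ≠
        some (w n).1 := by
      rw [CoprodI.Word.fstIdx, ih]
      cases n with
      | zero => simp
      | succ n => simpa [List.range_succ] using (hw n).2
    rw [wordPrefix_succ, mul_inv_rev, mul_smul, ← map_inv,
      ← CoprodI.Word.cons_eq_smul (h1 := hidx) (h2 := by simpa using (hw n).1),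
      CoprodI.Word.cons_toList, ih, List.range_succ]
    simp

theorem dist_one_wordPrefix (hgen : ∀ i, Subgroup.closure (S i) = ⊤) {w : ℕ → Σ i, Γ i}
    (hw : IsInfiniteWord w) (n : ℕ) :
    (freeProductGraph S).dist 1 (wordPrefix w n) =
      ∑ k ∈ Finset.range n, letterLength S (w k) := by
  classical
  apply le_antisymm
  · induction n with
    | zero => simp [wordPrefix]
    | succ n ih =>
      rw [Finset.sum_range_succ, wordPrefix_succ]
      exact ((freeProductGraph_connected hgen).dist_triangle (v := wordPrefix w n)).trans
        (add_le_add ih (freeProductGraph_dist_mul_of_le hgen _ _))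
  · refine le_trans (le_of_eq ?_) (wordLength_inv_smul_empty_le hgen _)
    rw [wordLength, toList_inv_wordPrefix_smul_empty hw, List.map_map, List.map_reverse,
      List.sum_reverse]
    simp only [Function.comp_def, letterLength_inv hgen]
    rfl

theorem wordPrefix_injective {w : ℕ → Σ i, Γ i} (hw : IsInfiniteWord w) :
    Function.Injective (wordPrefix w) := by
  classical
  intro m n h
  simpa [toList_inv_wordPrefix_smul_empty hw] using
    congrArg (fun g : CoprodI Γ => (g⁻¹ • (CoprodI.Word.empty : CoprodI.Word Γ)).toList.length) h

theorem exists_graphRay_wordPrefix (hgen : ∀ i, Subgroup.closure (S i) = ⊤) {w : ℕ → Σ i, Γ i}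
    (hw : IsInfiniteWord w) :
    ∃ ρ : GraphRay (freeProductGraph S), ∀ n, wordPrefix w n ∈ Set.range ρ.vertex := by
  have hc := freeProductGraph_connected hgen
  have h0 : wordPrefix w 0 = 1 := by simp [wordPrefix]
  refine hc.exists_graphRay _ (fun n h => ?_) fun n => le_antisymm hc.dist_triangle ?_
  · simpa using wordPrefix_injective hw h
  · rw [h0, dist_one_wordPrefix hgen hw, dist_one_wordPrefix hgen hw, Finset.sum_range_succ,
      wordPrefix_succ]
    exact Nat.add_le_add_left (freeProductGraph_dist_mul_of_le hgen _ _) _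

open Classical in
-- Multiplication by an element of one factor can only alter, add or delete the head letter.
theorem suffix_toList_of_smul {i : ι} (s : Γ i) {w : CoprodI.Word Γ} {L : List (Σ i, Γ i)}
    (hL : L <:+ w.toList) (hne : L ≠ w.toList) : L <:+ (CoprodI.of s • w).toList := by
  obtain ⟨p, rfl⟩ := (CoprodI.Word.equivPair i).symm.surjective w
  rw [CoprodI.Word.equivPair_symm] at hL hne
  have htail : ∀ q : CoprodI.Word.Pair Γ i, q.tail.toList <:+ (CoprodI.Word.rcons q).toList := by
    intro q
    unfold CoprodI.Word.rcons
    split_ifs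
    · exact List.suffix_rfl
    · exact List.suffix_cons _ _
  have hp : L <:+ p.tail.toList := by
    unfold CoprodI.Word.rcons at hL hne
    split_ifs at hL hne with h
    · exact hL
    · exact (List.suffix_cons_iff.1 hL).resolve_left hne
  rw [CoprodI.Word.of_smul_def, Equiv.apply_symm_apply]
  exact hp.trans (htail ⟨s * p.head, p.tail, p.fstIdx_ne⟩)

open Classical in
-- The vertex `q` separates the elements with prefix `q` from the rest: a walk that avoids `q` keeps
-- the word of `q⁻¹` a proper suffix at each vertex, hence also after the next edge.
theorem suffix_toList_of_mem_componentCompl {K : Set (CoprodI Γ)} {q g h : CoprodI Γ} (hq : q ∈ K)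
    {C : (freeProductGraph S).ComponentCompl K} (hg : g ∈ C) (hh : h ∈ C)
    (hqg : (q⁻¹ • (CoprodI.Word.empty : CoprodI.Word Γ)).toList <:+
      (g⁻¹ • (CoprodI.Word.empty : CoprodI.Word Γ)).toList) :
    (q⁻¹ • (CoprodI.Word.empty : CoprodI.Word Γ)).toList <:+
      (h⁻¹ • (CoprodI.Word.empty : CoprodI.Word Γ)).toList := by
  have hinj : ∀ x y : CoprodI Γ, (x⁻¹ • (CoprodI.Word.empty : CoprodI.Word Γ)).toList =
      (y⁻¹ • (CoprodI.Word.empty : CoprodI.Word Γ)).toList → x = y := fun x y hxy =>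
    inv_injective (CoprodI.Word.equiv.injective (CoprodI.Word.ext hxy))
  have key : ∀ {a b : (Kᶜ : Set (CoprodI Γ))}
      (_ : ((freeProductGraph S).induce Kᶜ).Walk a b),
      (q⁻¹ • (CoprodI.Word.empty : CoprodI.Word Γ)).toList <:+
        ((a : CoprodI Γ)⁻¹ • (CoprodI.Word.empty : CoprodI.Word Γ)).toList →
      (q⁻¹ • (CoprodI.Word.empty : CoprodI.Word Γ)).toList <:+
        ((b : CoprodI Γ)⁻¹ • (CoprodI.Word.empty : CoprodI.Word Γ)).toList := by
    intro a b p
    induction p with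
    | nil => exact id
    | @cons a b c hadj p ih =>
      intro ha
      obtain ⟨i, s, hs, -⟩ :=
        exists_of_mul_inv_of_adj (S := S) (g := (a : CoprodI Γ)) (h := (b : CoprodI Γ)) hadj
      refine ih ?_
      rw [hs, mul_smul]
      refine suffix_toList_of_smul s ha fun he => ?_
      exact a.2 (hinj _ _ he ▸ hq)
  obtain ⟨hgK, rfl⟩ := hg
  obtain ⟨hhK, hh⟩ := hh
  obtain ⟨p⟩ := ConnectedComponent.exact hh.symm
  exact key p hqg

theorem eq_of_suffix_wordPrefix {w v : ℕ → Σ i, Γ i} {n N : ℕ} (hnN : n ≤ N)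
    (h : ((List.range n).reverse.map fun k => (⟨(w k).1, (w k).2⁻¹⟩ : Σ i, Γ i)) <:+
      (List.range N).reverse.map fun k => ⟨(v k).1, (v k).2⁻¹⟩) :
    ∀ k < n, v k = w k := by
  have hsuf : ((List.range n).reverse.map fun k => (⟨(v k).1, (v k).2⁻¹⟩ : Σ i, Γ i)) <:+
      (List.range N).reverse.map fun k => ⟨(v k).1, (v k).2⁻¹⟩ := by
    obtain ⟨m, rfl⟩ := Nat.exists_eq_add_of_le hnN
    rw [List.range_add, List.reverse_append, List.map_append]
    exact List.suffix_append _ _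
  have heq := (List.suffix_of_suffix_length_le hsuf h (by simp)).eq_of_length (by simp)
  intro k hk
  have hk' := List.map_inj_left.1 heq k (by simpa using hk)
  generalize v k = a, w k = b at hk'
  obtain ⟨i, a⟩ := a
  obtain ⟨j, b⟩ := b
  obtain rfl : i = j := congrArg Sigma.fst hk'
  simpa using hk'

theorem exists_le_wordPrefix_mem {w : ℕ → Σ i, Γ i} (hw : IsInfiniteWord w)
    {ρ : GraphRay (freeProductGraph S)} (hρ : ∀ n, wordPrefix w n ∈ Set.range ρ.vertex)
    {A : Set (CoprodI Γ)} (hA : ρ.toEnd.ContainedIn A) (n : ℕ) :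
    ∃ N, n ≤ N ∧ wordPrefix w N ∈ A := by
  choose t ht using hρ
  have htinj : Function.Injective t := fun a b hab =>
    wordPrefix_injective hw (by rw [← ht a, ← ht b, hab])
  obtain ⟨N, hN⟩ := ((htinj.nat_tendsto_atTop.eventually hA.eventually).and
    (Filter.eventually_ge_atTop n)).exists
  exact ⟨N, hN.2, ht N ▸ hN.1⟩

/-- If two ends described by infinite words lie in the same component after the removal of a ball
that contains the `n`-th prefix of one of them, then the words agree in the first `n` letters. -/
theorem eq_of_sameComponent (hgen : ∀ i, Subgroup.closure (S i) = ⊤) {w v : ℕ → Σ i, Γ i}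
    (hw : IsInfiniteWord w) (hv : IsInfiniteWord v) {ρ σ : GraphRay (freeProductGraph S)}
    (hρ : ∀ n, wordPrefix w n ∈ Set.range ρ.vertex)
    (hσ : ∀ n, wordPrefix v n ∈ Set.range σ.vertex) {m n : ℕ}
    (hm : ∑ k ∈ Finset.range n, letterLength S (w k) < m)
    (h : GraphEnd.SameComponent 1 m ρ.toEnd σ.toEnd) : ∀ k < n, v k = w k := by
  classical
  obtain ⟨C, hC, hC'⟩ := h
  obtain ⟨M, hM, hMC⟩ := exists_le_wordPrefix_mem hw hρ hC n
  obtain ⟨N, hN, hNC⟩ := exists_le_wordPrefix_mem hv hσ hC' n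
  refine eq_of_suffix_wordPrefix hN ?_
  rw [← toList_inv_wordPrefix_smul_empty hw, ← toList_inv_wordPrefix_smul_empty hv]
  refine suffix_toList_of_mem_componentCompl
    (K := {g | (freeProductGraph S).dist 1 g < m}) ?_ hMC hNC ?_
  · simpa [dist_one_wordPrefix hgen hw] using hm
  · rw [toList_inv_wordPrefix_smul_empty hw, toList_inv_wordPrefix_smul_empty hw]
    obtain ⟨d, rfl⟩ := Nat.exists_eq_add_of_le hM
    rw [List.range_add, List.reverse_append, List.map_append]
    exact List.suffix_append _ _

end InfiniteWords

/-! ### Null sets from countably many pieces. -/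

section BallCovers

variable {X : Type*}

/-- Each piece gets its share of a summable error and is covered by balls of one radius. The centres
need to lie only in `A`, not in the piece. -/
theorem ballHausdorffMeasure_eq_zero_of_countable_cover {κ : Type*} [Countable κ]
    {d : X → X → ℝ} {δ : ℝ≥0} {A : Set X} {B : κ → Set X} (hA : A ⊆ ⋃ k, B k)
    (h : ∀ k, ∀ ε : ℝ, 0 < ε → ∀ η : ℝ≥0∞, η ≠ 0 → ∃ r : ℝ, 0 < r ∧ r < ε ∧ ∃ F ⊆ A,
      F.Countable ∧ F.encard * ENNReal.ofReal r ^ (δ : ℝ) ≤ η ∧ ∀ x ∈ B k, ∃ c ∈ F, d c x ≤ r) :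
    ballHausdorffMeasure d δ A = 0 := by
  simp only [ballHausdorffMeasure, ENNReal.iSup_eq_zero]
  intro ε hε
  refine le_antisymm (ENNReal.le_of_forall_pos_le_add fun η hη _ => ?_) bot_le
  obtain ⟨η', hη', hsum⟩ := ENNReal.exists_pos_sum_of_countable'
    (ENNReal.coe_ne_zero.2 hη.ne') κ
  choose r hr0 hrε F hFA hFc hF hcov using fun k => h k ε hε (η' k) (hη' k).ne'
  have hT : IsBallCover d A ε (⋃ k, F k ×ˢ {r k}) := by
    refine ⟨Set.countable_iUnion fun k => (hFc k).prod (Set.countable_singleton _), ?_, ?_⟩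
    · rintro ⟨c, s⟩ hp
      obtain ⟨k, hc, hs⟩ := Set.mem_iUnion.1 hp
      obtain rfl : s = r k := hs
      exact ⟨hFA k hc, hr0 k, hrε k⟩
    · intro x hx
      obtain ⟨k, hk⟩ := Set.mem_iUnion.1 (hA hx)
      obtain ⟨c, hc, hcx⟩ := hcov k x hk
      exact Set.mem_biUnion (x := (c, r k)) (Set.mem_iUnion.2 ⟨k, hc, rfl⟩) hcx
  refine (iInf₂_le _ hT).trans ?_
  rw [zero_add]
  refine (ENNReal.tsum_iUnion_le_tsum
    (fun p : X × ℝ => ENNReal.ofReal p.2 ^ (δ : ℝ)) _).trans ?_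
  refine (ENNReal.tsum_le_tsum fun k => ?_).trans hsum.le
  refine le_trans (le_of_eq ?_) (hF k)
  have hconst : ∀ p : (F k ×ˢ {r k} : Set (X × ℝ)),
      ENNReal.ofReal p.1.2 ^ (δ : ℝ) = ENNReal.ofReal (r k) ^ (δ : ℝ) := by
    rintro ⟨⟨c, s⟩, -, hs⟩
    obtain rfl : s = r k := hs
    rfl
  rw [tsum_congr hconst, ENNReal.tsum_set_const, Set.encard_prod, Set.encard_singleton, mul_one]

end BallCovers

/-! ### Upper bound for the ends of a factor. -/

section FactorEnds

open Monoid SimpleGraph Filter Topology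

variable {ι : Type*} {Γ : ι → Type*} [∀ i, Group (Γ i)] {S : ∀ i, Set (Γ i)}

theorem countable_coprodI [Finite ι] (hfin : ∀ i, (S i).Finite)
    (hgen : ∀ i, Subgroup.closure (S i) = ⊤) : Countable (CoprodI Γ) := by
  rw [← Set.countable_univ_iff]
  refine (Set.countable_iUnion fun m : ℕ =>
    (freeProductGraph_finite_dist_lt hfin hgen m).countable).mono fun g _ => ?_
  exact Set.mem_iUnion.2 ⟨(freeProductGraph S).dist 1 g + 1, Nat.lt_succ_self _⟩

theorem exists_endDist_cover_factorCopy [Finite ι] (hfin : ∀ i, (S i).Finite)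
    (hgen : ∀ i, Subgroup.closure (S i) = ⊤) {α : ℝ} (hα0 : 0 < α) (hα1 : α < 1) (i : ι)
    (x : CoprodI Γ) (k : ℕ) :
    ∃ F ⊆ factorEnds S i, F.encard ≤
        ({g | (mulCayley (S i)).dist 1 g = k + (freeProductGraph S).dist 1 x}.ncard : ℕ) ∧
      ∀ ξ : GraphEnd (mulCayley (S i)), ∃ c ∈ F, GraphEnd.endDist 1 α c
        (ξ.map (factorCopy S i x) (factorCopy_injective S i x)) ≤ α ^ k := by
  set m := k + (freeProductGraph S).dist 1 x with hm
  have hc := freeProductGraph_connected hgen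
  -- The factor embeds isometrically and translation by `x` lowers the distance to `1` by at most
  -- $l(x)$; this explains the radius `m`.
  have hdist : ∀ y, y ∉ {g | (mulCayley (S i)).dist 1 g < m} →
      ¬ (freeProductGraph S).dist 1 (factorCopy S i x y) < k := by
    intro y hy
    have h₁ : m ≤ letterLength S ⟨i, y⟩ := not_lt.1 hy
    have h₂ := letterLength_le_dist_of hgen y
    have h₃ := mulCayley_dist_mul_left (closure_iUnion_of_image_eq_top hgen) x 1 (CoprodI.of y)
    have h₄ := hc.dist_triangle (u := x) (v := 1) (w := x * CoprodI.of y)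
    rw [dist_comm (u := x) (v := 1)] at h₄
    change ¬ (freeProductGraph S).dist 1 (x * CoprodI.of y) < k
    change (freeProductGraph S).dist (x * 1) (x * CoprodI.of y) = _ at h₃
    rw [mul_one] at h₃
    change _ ≤ (freeProductGraph S).dist _ _ at h₂
    change _ = (freeProductGraph S).dist 1 (CoprodI.of y) at h₃
    lia
  let R : Γ i → GraphRay (mulCayley (S i)) → Prop := fun z ρ =>
    ∃ C : (mulCayley (S i)).ComponentCompl {g | (mulCayley (S i)).dist 1 g < m},
      z ∈ C ∧ ∀ᶠ n in atTop, ρ.vertex n ∈ C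
  -- Only sphere points whose component contains the tail of a ray are kept: the picked ray then
  -- supplies a centre inside the set to be covered.
  let Z : Set (Γ i) := {z | (mulCayley (S i)).dist 1 z = m ∧ ∃ ρ, R z ρ}
  choose pick hpick using fun z : Z => z.2.2
  let e : Z → GraphEnd (freeProductGraph S) := fun z =>
    ((pick z).map (factorCopy S i x) (factorCopy_injective S i x)).toEnd
  refine ⟨e '' Set.univ, ?_, ?_, fun ξ => ?_⟩
  · rintro _ ⟨z, -, rfl⟩
    exact ⟨x, (pick z).toEnd, rfl⟩
  · refine (Set.encard_image_le _ _).trans ?_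
    rw [Set.encard_univ, ENat.card_coe_set_eq, (mulCayley_finite_dist_eq (hfin i) (hgen i) m).cast_ncard_eq]
    exact Set.encard_le_encard fun z hz => hz.1
  · obtain ⟨ρ, rfl⟩ := ξ.exists_toEnd_eq
    obtain ⟨C, hC⟩ := ρ.exists_componentCompl (mulCayley_finite_dist_lt (hfin i) (hgen i) m)
    obtain ⟨z, hz, hzm⟩ := (mulCayley_connected (hgen i)).exists_dist_eq_mem_componentCompl C
    let z' : Z := ⟨z, hzm, ρ, C, hz, hC⟩
    refine ⟨e z', ⟨z', trivial, rfl⟩, GraphEnd.endDist_le_pow hα0 hα1 ?_⟩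
    obtain ⟨D, hzD, hD⟩ := hpick z'
    obtain rfl : C = D := by
      by_contra hne
      exact Set.disjoint_left.1 (ComponentCompl.pairwise_disjoint hne) hz hzD
    exact GraphRay.sameComponent_map (factorCopy_injective S i x)
      (freeProductGraph_finite_dist_lt hfin hgen k) hdist hD hC

theorem ballHausdorffMeasure_factorEnds_eq_zero [Finite ι] (hfin : ∀ i, (S i).Finite)
    (hgen : ∀ i, Subgroup.closure (S i) = ⊤) {α : ℝ} (hα0 : 0 < α) (hα1 : α < 1) (i : ι) {δ : ℝ≥0}
    (h : Tendsto (fun m : ℕ => ({g | (mulCayley (S i)).dist 1 g = m}.ncard : ℝ) *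
      (α ^ (δ : ℝ)) ^ m) atTop (𝓝 0)) :
    ballHausdorffMeasure (GraphEnd.endDist 1 α) δ (factorEnds S i) = 0 := by
  have := countable_coprodI hfin hgen
  refine ballHausdorffMeasure_eq_zero_of_countable_cover
    (B := fun x : CoprodI Γ => Set.range fun ξ : GraphEnd (mulCayley (S i)) =>
      ξ.map (factorCopy S i x) (factorCopy_injective S i x)) ?_ fun x ε hε η hη => ?_
  · rintro _ ⟨x, ξ, rfl⟩
    exact Set.mem_iUnion.2 ⟨x, ξ, rfl⟩
  set l := (freeProductGraph S).dist 1 x with hl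
  set t := α ^ (δ : ℝ) with ht
  have ht0 : 0 < t := Real.rpow_pos_of_pos hα0 _
  have h₁ : Tendsto (fun k : ℕ => ({g | (mulCayley (S i)).dist 1 g = k + l}.ncard : ℝ) * t ^ k)
      atTop (𝓝 0) := by
    -- The shift by `l` costs only the constant factor $t^{-l}$.
    have := ((tendsto_add_atTop_iff_nat l).2 h).mul_const (t ^ l)⁻¹
    rw [zero_mul] at this
    refine this.congr fun k => ?_
    rw [pow_add, ← mul_assoc, mul_inv_cancel_right₀ (pow_ne_zero _ ht0.ne')]
  have h₂ := ENNReal.tendsto_ofReal h₁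
  rw [ENNReal.ofReal_zero] at h₂
  obtain ⟨k, hkη, hkε⟩ := ((h₂.eventually_le_const (pos_iff_ne_zero.2 hη)).and
    ((tendsto_pow_atTop_nhds_zero_of_lt_one hα0.le hα1).eventually_lt_const hε)).exists
  obtain ⟨F, hFA, hF, hcov⟩ := exists_endDist_cover_factorCopy hfin hgen hα0 hα1 i x k
  refine ⟨α ^ k, by positivity, hkε, F, hFA, ?_, ?_, ?_⟩
  · exact (Set.finite_of_encard_le_coe hF).countable
  · refine le_trans ?_ hkη
    rw [ENNReal.ofReal_mul (Nat.cast_nonneg _), ENNReal.ofReal_natCast,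
      ENNReal.ofReal_rpow_of_pos (by positivity), ← Real.rpow_natCast_mul hα0.le, mul_comm (k : ℝ),
      Real.rpow_mul_natCast hα0.le]
    gcongr
    exact_mod_cast hF
  · rintro _ ⟨ξ, rfl⟩
    exact hcov ξ

end FactorEnds

/-! ### Mass distribution principle for coded sets. -/

section MassDistribution

open MeasureTheory Filter

variable {X : Type*}

/-- The Bernoulli measure with the given weights, normalized, on the sequences of elements of a
finite set; the weight of a cylinder is at most the product of the weights of its entries. -/
theorem exists_probabilityMeasure_cylinder_le {B : Type*} [Fintype B] [MeasurableSpace B]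
    [MeasurableSingletonClass B] {a : B → ℝ} (ha : ∀ b, 0 ≤ a b) (hsum : 1 ≤ ∑ b, a b) :
    ∃ μ : Measure (ℕ → B), IsProbabilityMeasure μ ∧ ∀ (b : ℕ → B) (n : ℕ),
      μ {b' | ∀ k < n, b' k = b k} ≤ ENNReal.ofReal (∏ k ∈ Finset.range n, a (b k)) := by
  have hs : 0 < ∑ b, a b := zero_lt_one.trans_le hsum
  let q : PMF B := PMF.ofFintype (fun b => ENNReal.ofReal (a b / ∑ b, a b)) (by
    rw [← ENNReal.ofReal_sum_of_nonneg fun b _ => div_nonneg (ha b) hs.le, ← Finset.sum_div,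
      div_self hs.ne', ENNReal.ofReal_one])
  refine ⟨Measure.infinitePi fun _ => q.toMeasure, inferInstance, fun b n => ?_⟩
  have hcyl : {b' : ℕ → B | ∀ k < n, b' k = b k} =
      Set.pi (Finset.range n) fun k => ({b k} : Set B) := by
    ext b'
    simp
  rw [hcyl, Measure.infinitePi_pi _ fun k _ => measurableSet_singleton _,
    ENNReal.ofReal_prod_of_nonneg fun k _ => ha _]
  refine Finset.prod_le_prod' fun k _ => ?_
  rw [PMF.toMeasure_apply_singleton _ _ (measurableSet_singleton _)]
  exact ENNReal.ofReal_le_ofReal (div_le_self (ha _) hsum)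

/-- A ball of radius about $\alpha^m$ meets the coded points in a single cylinder of total length at
least `m + 1 - L`, whose mass is comparable to $\alpha^{\delta m}$. Summing over a cover bounds the
total mass 1. -/
theorem ballHausdorffMeasure_ne_zero_of_coding {B : Type*} [Fintype B] {d : X → X → ℝ} {A : Set X}
    {α : ℝ} (hα0 : 0 < α) (hα1 : α < 1) {δ : ℝ≥0} {len : B → ℕ} (hlen : ∀ b, 0 < len b)
    (hsum : 1 ≤ ∑ b, (α ^ (δ : ℝ)) ^ len b) {F : (ℕ → B) → X} (hF : ∀ b, F b ∈ A)
    (hsep : ∀ c ∈ A, ∀ m b b', d c (F b) < α ^ m → d c (F b') < α ^ m →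
      ∀ n, ∑ k ∈ Finset.range n, len (b k) ≤ m → ∀ k < n, b' k = b k) :
    ballHausdorffMeasure d δ A ≠ 0 := by
  let : MeasurableSpace B := ⊤
  have : MeasurableSingletonClass B := ⟨fun _ => trivial⟩
  set t := α ^ (δ : ℝ) with ht
  have ht0 : 0 < t := Real.rpow_pos_of_pos hα0 _
  have ht1 : t ≤ 1 := Real.rpow_le_one hα0.le hα1.le δ.2
  obtain ⟨μ, hμ, hcyl⟩ := exists_probabilityMeasure_cylinder_le
    (a := fun b => t ^ len b) (fun b => (pow_pos ht0 _).le) hsum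
  set L := ∑ b, len b with hL
  have hball : ∀ c ∈ A, ∀ ε : ℝ, 0 < ε → ε < 1 →
      ENNReal.ofReal (t ^ L) * μ {b | d c (F b) ≤ ε} ≤ ENNReal.ofReal ε ^ (δ : ℝ) := by
    intro c hc ε hε0 hε1
    obtain hE | ⟨b, hb⟩ := {b | d c (F b) ≤ ε}.eq_empty_or_nonempty
    · simp [hE]
    have hex : ∃ m : ℕ, α ^ m ≤ ε :=
      ((tendsto_pow_atTop_nhds_zero_of_lt_one hα0.le hα1).eventually_le_const hε0).exists
    obtain ⟨m, hm1, hm2⟩ : ∃ m : ℕ, α ^ (m + 1) ≤ ε ∧ ε < α ^ m := by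
      classical
      have h0 : Nat.find hex ≠ 0 := fun h => by
        have := Nat.find_spec hex
        rw [h, pow_zero] at this
        linarith
      obtain ⟨m, hm⟩ := Nat.exists_eq_succ_of_ne_zero h0
      exact ⟨m, by simpa [hm] using Nat.find_spec hex,
        not_le.1 (Nat.find_min hex (m := m) (by lia))⟩
    have hgrow : ∀ n, n ≤ ∑ k ∈ Finset.range n, len (b k) := fun n => by
      simpa using Finset.card_nsmul_le_sum (Finset.range n) (fun k => len (b k)) 1
        fun k _ => hlen (b k)
    obtain ⟨n, hn1, hn2⟩ : ∃ n, ∑ k ∈ Finset.range n, len (b k) ≤ m ∧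
        m < ∑ k ∈ Finset.range (n + 1), len (b k) := by
      classical
      have hex' : ∃ n, m < ∑ k ∈ Finset.range n, len (b k) := ⟨m + 1, hgrow (m + 1)⟩
      have h0 : Nat.find hex' ≠ 0 := fun h => by
        have := Nat.find_spec hex'
        simp [h] at this
      obtain ⟨n, hn⟩ := Nat.exists_eq_succ_of_ne_zero h0
      exact ⟨n, not_lt.1 (Nat.find_min hex' (m := n) (by lia)),
        by simpa [hn] using Nat.find_spec hex'⟩
    -- One further letter overshoots `m`, and `L` dominates the length of every letter.
    have hnL : m + 1 ≤ L + ∑ k ∈ Finset.range n, len (b k) := by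
      rw [Finset.sum_range_succ] at hn2
      have : len (b n) ≤ L := Finset.single_le_sum (f := len) (fun _ _ => Nat.zero_le _)
        (Finset.mem_univ (b n))
      lia
    have hsub : {b | d c (F b) ≤ ε} ⊆ {b' | ∀ k < n, b' k = b k} := fun b' hb' =>
      hsep c hc m b b' (hb.trans_lt hm2) (lt_of_le_of_lt hb' hm2) n hn1
    calc ENNReal.ofReal (t ^ L) * μ {b | d c (F b) ≤ ε}
        ≤ ENNReal.ofReal (t ^ L) * ENNReal.ofReal (∏ k ∈ Finset.range n, t ^ len (b k)) := by
          gcongr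
          exact (measure_mono hsub).trans (hcyl b n)
      _ = ENNReal.ofReal (t ^ (L + ∑ k ∈ Finset.range n, len (b k))) := by
          rw [← ENNReal.ofReal_mul (by positivity), Finset.prod_pow_eq_pow_sum, pow_add]
      _ ≤ ENNReal.ofReal (t ^ (m + 1)) :=
          ENNReal.ofReal_le_ofReal (pow_le_pow_of_le_one ht0.le ht1 hnL)
      _ = ENNReal.ofReal (α ^ (m + 1)) ^ (δ : ℝ) := by
          rw [ENNReal.ofReal_rpow_of_pos (by positivity), ← Real.rpow_natCast_mul hα0.le,
            mul_comm, Real.rpow_mul_natCast hα0.le]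
      _ ≤ ENNReal.ofReal ε ^ (δ : ℝ) := by gcongr
  have hle : ENNReal.ofReal (t ^ L) ≤ ballHausdorffMeasure d δ A := by
    -- Scale 1 suffices: `hball` needs radii below 1 so that `m` exists.
    refine le_trans ?_ (le_iSup₂ (1 : ℝ) zero_lt_one)
    refine le_iInf₂ fun T hT => ?_
    obtain ⟨hTc, hT, hcov⟩ := hT
    have huniv : (Set.univ : Set (ℕ → B)) ⊆ ⋃ p ∈ T, {b | d p.1 (F b) ≤ p.2} := fun b _ => by
      simpa using hcov (hF b)
    calc ENNReal.ofReal (t ^ L) = ENNReal.ofReal (t ^ L) * μ Set.univ := by simp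
      _ ≤ ENNReal.ofReal (t ^ L) * ∑' p : T, μ {b | d p.1.1 (F b) ≤ p.1.2} := by
          gcongr
          exact (measure_mono huniv).trans (measure_biUnion_le μ hTc _)
      _ = ∑' p : T, ENNReal.ofReal (t ^ L) * μ {b | d p.1.1 (F b) ≤ p.1.2} :=
          ENNReal.tsum_mul_left.symm
      _ ≤ ∑' p : T, ENNReal.ofReal p.1.2 ^ (δ : ℝ) :=
          ENNReal.tsum_le_tsum fun p => hball _ (hT p p.2).1 _ (hT p p.2).2.1 (hT p p.2).2.2
  exact (lt_of_lt_of_le (ENNReal.ofReal_pos.2 (pow_pos ht0 _)) hle).ne'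

end MassDistribution

/-! ### Lower bound from alternating words. -/

section WordEnds

open Monoid SimpleGraph

variable {ι : Type*} {Γ : ι → Type*}

/-- The infinite word whose letters are taken alternately from the two components of a sequence of
pairs. -/
def alternatingWord {i : ι} {T : Finset (Γ i)} {Y : Finset (Σ k, Γ k)} (b : ℕ → T × Y) (n : ℕ) :
    Σ k, Γ k :=
  if n % 2 = 0 then ⟨i, (b (n / 2)).1⟩ else (b (n / 2)).2

section

variable {i : ι} {T : Finset (Γ i)} {Y : Finset (Σ k, Γ k)} (b : ℕ → T × Y)

theorem alternatingWord_two_mul (n : ℕ) : alternatingWord b (2 * n) = ⟨i, (b n).1⟩ := by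
  simp [alternatingWord]

theorem alternatingWord_two_mul_add_one (n : ℕ) : alternatingWord b (2 * n + 1) = (b n).2 := by
  have : (2 * n + 1) / 2 = n := by lia
  simp [alternatingWord, this]

variable [∀ i, Group (Γ i)] {S : ∀ i, Set (Γ i)}

theorem isInfiniteWord_alternatingWord (hT : ∀ x ∈ T, x ≠ 1) (hY : ∀ y ∈ Y, y.2 ≠ 1 ∧ y.1 ≠ i) :
    IsInfiniteWord (alternatingWord b) := by
  intro n
  obtain ⟨k, rfl | rfl⟩ := n.even_or_odd'
  · rw [alternatingWord_two_mul, alternatingWord_two_mul_add_one]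
    exact ⟨hT _ (b k).1.2, (hY _ (b k).2.2).2.symm⟩
  · rw [alternatingWord_two_mul_add_one, show 2 * k + 1 + 1 = 2 * (k + 1) by lia,
      alternatingWord_two_mul]
    exact hY _ (b k).2.2

theorem sum_letterLength_alternatingWord (n : ℕ) :
    ∑ k ∈ Finset.range (2 * n), letterLength S (alternatingWord b k) =
      ∑ k ∈ Finset.range n, (letterLength S ⟨i, (b k).1⟩ + letterLength S (b k).2.1) := by
  induction n with
  | zero => simp
  | succ n ih =>
    rw [show 2 * (n + 1) = 2 * n + 1 + 1 by lia, Finset.sum_range_succ, Finset.sum_range_succ, ih,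
      Finset.sum_range_succ _ n, alternatingWord_two_mul, alternatingWord_two_mul_add_one, add_assoc]

end

variable [∀ i, Group (Γ i)] {S : ∀ i, Set (Γ i)}

theorem ballHausdorffMeasure_infiniteWordEnds_ne_zero (hgen : ∀ i, Subgroup.closure (S i) = ⊤)
    {α : ℝ} (hα0 : 0 < α) (hα1 : α < 1) {δ : ℝ≥0} {i : ι} {T : Finset (Γ i)}
    {Y : Finset (Σ k, Γ k)} (hT : ∀ x ∈ T, x ≠ 1) (hY : ∀ y ∈ Y, y.2 ≠ 1 ∧ y.1 ≠ i)
    (hsum : 1 ≤ (∑ x ∈ T, (α ^ (δ : ℝ)) ^ letterLength S ⟨i, x⟩) *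
      ∑ y ∈ Y, (α ^ (δ : ℝ)) ^ letterLength S y) :
    ballHausdorffMeasure (GraphEnd.endDist 1 α) δ (infiniteWordEnds S) ≠ 0 := by
  choose ρ hρ using fun b : ℕ → T × Y =>
    exists_graphRay_wordPrefix hgen (isInfiniteWord_alternatingWord b hT hY)
  refine ballHausdorffMeasure_ne_zero_of_coding hα0 hα1 (B := T × Y)
    (len := fun b => letterLength S ⟨i, b.1⟩ + letterLength S b.2.1)
    (fun b => Nat.add_pos_left (letterLength_pos hgen (hT _ b.1.2)) _) ?_
    (F := fun b => (ρ b).toEnd)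
    (fun b => ⟨_, isInfiniteWord_alternatingWord b hT hY, ρ b, rfl, hρ b⟩) ?_
  · rw [← Finset.sum_coe_sort T, ← Finset.sum_coe_sort Y, Finset.sum_mul_sum,
      ← Fintype.sum_prod_type'] at hsum
    simpa only [pow_add] using hsum
  · intro c _ m b b' hb hb' n hn k hk
    have h := (GraphEnd.sameComponent_of_endDist_lt hα0 hα1 hb).trans_left
      (GraphEnd.sameComponent_of_endDist_lt hα0 hα1 hb')
    -- Each symbol of the code is a block of two letters, whence `2 * n`. The extra layer `m + 1`
    -- turns the bound `≤ m` on the length into the required strict one.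
    have hagree := eq_of_sameComponent hgen (isInfiniteWord_alternatingWord b hT hY)
      (isInfiniteWord_alternatingWord b' hT hY) (hρ b) (hρ b') (n := 2 * n)
      (by rw [sum_letterLength_alternatingWord]; lia) h
    have h₁ := hagree (2 * k) (by lia)
    have h₂ := hagree (2 * k + 1) (by lia)
    rw [alternatingWord_two_mul, alternatingWord_two_mul] at h₁
    rw [alternatingWord_two_mul_add_one, alternatingWord_two_mul_add_one] at h₂
    exact Prod.ext (Subtype.ext (by simpa using h₁)) (Subtype.ext h₂)

end WordEnds

/-! ### Critical exponent of a submultiplicative sequence. -/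

section Growth

open Filter Topology

/-- Take $c=\lim(\log s_m/m)/(-\log\alpha)$. By Fekete the limit is also the infimum, which gives
the bound at `c` for every `m`; beyond `c` the decay is geometric. -/
theorem exists_critical_exponent {s : ℕ → ℕ} (hpos : ∀ m, 1 ≤ s m)
    (hmul : ∀ m n, s (m + n) ≤ s m * s n) {α : ℝ} (hα0 : 0 < α) (hα1 : α < 1) :
    ∃ c : ℝ≥0, (∀ m, 1 ≤ (s m : ℝ) * (α ^ (c : ℝ)) ^ m) ∧
      ∀ δ : ℝ≥0, c < δ → Tendsto (fun m => (s m : ℝ) * (α ^ (δ : ℝ)) ^ m) atTop (𝓝 0) := by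
  have hs : ∀ m, (0 : ℝ) < s m := fun m => by exact_mod_cast hpos m
  have hlog : 0 < -Real.log α := neg_pos.2 (Real.log_neg hα0 hα1)
  have hu : Subadditive fun m => Real.log (s m) := fun m n => by
    rw [← Real.log_mul (hs m).ne' (hs n).ne']
    exact Real.log_le_log (hs _) (by exact_mod_cast hmul m n)
  have hu0 : ∀ m : ℕ, 0 ≤ Real.log (s m) / m := fun m =>
    div_nonneg (Real.log_nonneg (by exact_mod_cast hpos m)) (Nat.cast_nonneg m)
  have hbdd : BddBelow (Set.range fun m : ℕ => Real.log (s m) / m) :=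
    ⟨0, by rintro _ ⟨m, rfl⟩; exact hu0 m⟩
  have hL0 : 0 ≤ hu.lim := ge_of_tendsto' (hu.tendsto_lim hbdd) hu0
  have hexp : ∀ (δ : ℝ) (m : ℕ), (s m : ℝ) * (α ^ δ) ^ m =
      Real.exp (Real.log (s m) - m * (δ * -Real.log α)) := fun δ m => by
    rw [Real.rpow_def_of_pos hα0, ← Real.exp_nat_mul, sub_eq_add_neg, Real.exp_add,
      Real.exp_log (hs m)]
    ring_nf
  refine ⟨NNReal.mk (hu.lim / -Real.log α) (div_nonneg hL0 hlog.le), fun m => ?_, fun δ hδ => ?_⟩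
  · rw [hexp, NNReal.coe_mk, div_mul_cancel₀ _ hlog.ne', Real.one_le_exp_iff, sub_nonneg]
    obtain rfl | hm := eq_or_ne m 0
    · simpa using Real.log_nonneg (by exact_mod_cast hpos 0)
    · rw [mul_comm, ← le_div_iff₀ (by positivity)]
      exact hu.lim_le_div hbdd hm
  · have hδ' : hu.lim < δ * -Real.log α := (div_lt_iff₀ hlog).1 hδ
    obtain ⟨M, hLM, hM⟩ := exists_between hδ'
    refine squeeze_zero' (g := fun m : ℕ => Real.exp (M - δ * -Real.log α) ^ m)
      (Eventually.of_forall fun m => by positivity) ?_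
      (tendsto_pow_atTop_nhds_zero_of_lt_one (Real.exp_pos _).le
        (Real.exp_lt_one_iff.2 (sub_neg.2 hM)))
    filter_upwards [(hu.tendsto_lim hbdd).eventually_lt_const hLM, eventually_gt_atTop 0]
      with m hm hm0
    rw [hexp, ← Real.exp_nat_mul, Real.exp_le_exp]
    rw [div_lt_iff₀ (by positivity)] at hm
    linarith

end Growth

/-! ### Choice of letters and comparison of exponents. -/

section Main

open Monoid SimpleGraph Filter Topology

theorem natCard_eq_two_of_forall_ne_one_eq {G : Type*} [Group G] [Nontrivial G]
    (h : ∀ x y : G, x ≠ 1 → y ≠ 1 → x = y) : Nat.card G = 2 := by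
  obtain ⟨g, hg⟩ := exists_ne (1 : G)
  refine Nat.card_eq_two_iff.2 ⟨1, g, hg.symm, Set.eq_univ_of_forall fun x => ?_⟩
  by_cases hx : x = 1
  · exact Or.inl hx
  · exact Or.inr (h x g hx hg)

/-- Unless there are just two factors, both of order two, two distinct nontrivial letters can be
found either in the factor `Γ i` or in the union of the other factors. -/
theorem exists_pair_of_letters {ι : Type*} [Fintype ι] (hι : 2 ≤ Fintype.card ι)
    (Γ : ι → Type*) [∀ i, Group (Γ i)] [∀ i, Nontrivial (Γ i)]
    (hΓ : ¬ (Fintype.card ι = 2 ∧ ∀ i, Nat.card (Γ i) = 2)) (i : ι) :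
    (∃ x y : Γ i, x ≠ 1 ∧ y ≠ 1 ∧ x ≠ y) ∨
      ∃ x y : Σ k, Γ k, (x.2 ≠ 1 ∧ x.1 ≠ i) ∧ (y.2 ≠ 1 ∧ y.1 ≠ i) ∧ x ≠ y := by
  by_contra! h
  obtain ⟨h₁, h₂⟩ := h
  have := Fintype.one_lt_card_iff_nontrivial.1 (show 1 < Fintype.card ι by lia)
  obtain ⟨j, hj⟩ := exists_ne i
  have hjk : ∀ k, k ≠ i → k = j := fun k hk => by
    obtain ⟨a, ha⟩ := exists_ne (1 : Γ k)
    obtain ⟨b, hb⟩ := exists_ne (1 : Γ j)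
    exact congrArg Sigma.fst (h₂ ⟨k, a⟩ ⟨j, b⟩ ⟨ha, hk⟩ ⟨hb, hj⟩)
  refine hΓ ⟨?_, fun k => natCard_eq_two_of_forall_ne_one_eq fun a b ha hb => ?_⟩
  · rw [← Nat.card_eq_fintype_card]
    refine Nat.card_eq_two_iff.2 ⟨i, j, hj.symm, Set.eq_univ_of_forall fun k => ?_⟩
    by_cases hk : k = i
    · exact Or.inl hk
    · exact Or.inr (hjk k hk)
  · by_cases hk : k = i
    · subst hk
      exact h₁ a b ha hb
    · simpa using h₂ ⟨k, a⟩ ⟨k, b⟩ ⟨ha, hk⟩ ⟨hb, hk⟩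

/-- There is an exponent beyond which the growth series of `Γ i` tends to zero termwise, while at
the exponent itself a finite piece of the growth series of a free product exceeds one. -/
theorem exists_exponent_one_lt_sum_mul_sum {ι : Type*} [Fintype ι] (hι : 2 ≤ Fintype.card ι)
    (Γ : ι → Type*) [∀ i, Group (Γ i)] [∀ i, Nontrivial (Γ i)]
    (hΓ : ¬ (Fintype.card ι = 2 ∧ ∀ i, Nat.card (Γ i) = 2))
    (S : ∀ i, Set (Γ i)) (hfin : ∀ i, (S i).Finite)
    (hgen : ∀ i, Subgroup.closure (S i) = ⊤) {α : ℝ} (hα0 : 0 < α) (hα1 : α < 1) (i : ι) :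
    ∃ c : ℝ≥0, (∀ δ : ℝ≥0, c < δ → Tendsto
        (fun m : ℕ => ({g | (mulCayley (S i)).dist 1 g = m}.ncard : ℝ) * (α ^ (δ : ℝ)) ^ m)
        atTop (𝓝 0)) ∧
      ∃ (T : Finset (Γ i)) (Y : Finset (Σ k, Γ k)), (∀ x ∈ T, x ≠ 1) ∧
        (∀ y ∈ Y, y.2 ≠ 1 ∧ y.1 ≠ i) ∧
        1 < (∑ x ∈ T, (α ^ (c : ℝ)) ^ letterLength S ⟨i, x⟩) *
          ∑ y ∈ Y, (α ^ (c : ℝ)) ^ letterLength S y := by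
  classical
  have := Fintype.one_lt_card_iff_nontrivial.1 (show 1 < Fintype.card ι by lia)
  obtain ⟨j, hj⟩ := exists_ne i
  obtain ⟨b, hb⟩ := exists_ne (1 : Γ j)
  obtain hΓi | hΓi := finite_or_infinite (Γ i)
  -- For finite `Γ i` the spheres are eventually empty, and at exponent 0 every letter has weight 1,
  -- so two letters on one side suffice.
  · refine ⟨0, fun δ _ => ?_, ?_⟩
    · obtain ⟨N, hN⟩ := (Set.finite_range fun g => (mulCayley (S i)).dist 1 g).bddAbove
      refine tendsto_const_nhds.congr' ?_
      filter_upwards [eventually_gt_atTop N] with m hm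
      have hempty : {g | (mulCayley (S i)).dist 1 g = m} = ∅ := by
        refine Set.eq_empty_of_forall_notMem fun g hg => ?_
        have := hN ⟨g, rfl⟩
        simp only [Set.mem_ofPred_eq] at hg
        lia
      simp [hempty]
    · obtain ⟨x, y, hx, hy, hxy⟩ | ⟨x, y, hx, hy, hxy⟩ := exists_pair_of_letters hι Γ hΓ i
      · exact ⟨{x, y}, {⟨j, b⟩}, by simp [hx, hy], by simp [hb, hj], by simp [hxy]⟩
      · obtain ⟨a, ha⟩ := exists_ne (1 : Γ i)
        refine ⟨{a}, {x, y}, by simp [ha], ?_, by simp [hxy]⟩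
        intro z hz
        obtain rfl | rfl := Finset.mem_insert.1 hz |>.imp_right Finset.mem_singleton.1
        exacts [hx, hy]
  · obtain ⟨c, hc, hδ⟩ := exists_critical_exponent
      (s := fun m => {g | (mulCayley (S i)).dist 1 g = m}.ncard)
      (fun m => (Set.ncard_pos (mulCayley_finite_dist_eq (hfin i) (hgen i) m)).2
        (mulCayley_exists_dist_eq (hfin i) (hgen i) m))
      (mulCayley_ncard_dist_eq_add_le (hfin i) (hgen i)) hα0 hα1
    refine ⟨c, hδ, ?_⟩
    set t := α ^ (c : ℝ) with ht
    have ht0 : 0 < t := Real.rpow_pos_of_pos hα0 _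
    -- Each of the spheres of radius 1 to `N` contributes at least 1 to the sum over `T`, which
    -- outweighs the single letter `b`.
    obtain ⟨N, hN⟩ := exists_nat_gt (t ^ letterLength S ⟨j, b⟩)⁻¹
    have hT := (mulCayley_finite_dist_lt (hfin i) (hgen i) (N + 1)).subset
      (Set.inter_subset_left (t := {1}ᶜ))
    refine ⟨hT.toFinset, {⟨j, b⟩}, by simp +contextual, by simp [hb, hj], ?_⟩
    rw [Finset.sum_singleton, ← inv_lt_iff_one_lt_mul₀ (pow_pos ht0 _)]
    refine hN.trans_le ?_
    have hmaps : ∀ x ∈ hT.toFinset, letterLength S ⟨i, x⟩ ∈ Finset.Icc 1 N := by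
      intro x hx
      simp only [Set.Finite.mem_toFinset, Set.mem_inter_iff, Set.mem_ofPred_eq,
        Set.mem_compl_iff, Set.mem_singleton_iff] at hx
      exact Finset.mem_Icc.2 ⟨letterLength_pos hgen hx.2, Nat.le_of_lt_succ hx.1⟩
    rw [← Finset.sum_fiberwise_of_maps_to hmaps]
    calc (N : ℝ) = ∑ m ∈ Finset.Icc 1 N, (1 : ℝ) := by simp
      _ ≤ _ := Finset.sum_le_sum fun m hm => ?_
    refine (hc m).trans (le_of_eq ?_)
    rw [Finset.sum_congr rfl fun x hx => by rw [(Finset.mem_filter.1 hx).2], Finset.sum_const,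
      nsmul_eq_mul, ← Set.ncard_coe_finset]
    congr 3
    ext x
    rw [Finset.mem_Icc] at hm
    simp only [Set.mem_ofPred_eq, Finset.coe_filter, Set.Finite.mem_toFinset, Set.mem_inter_iff,
      Set.mem_compl_iff, Set.mem_singleton_iff]
    change _ ↔ _ ∧ (mulCayley (S i)).dist 1 x = m
    refine ⟨fun h => ⟨⟨by lia, fun hx => ?_⟩, h⟩, fun h => h.2⟩
    rw [hx, dist_self] at h
    lia

end Main

end

theorem corollary3p6 {ι : Type*} [Fintype ι] (hι : 2 ≤ Fintype.card ι)
    (Γ : ι → Type*) [∀ i, Group (Γ i)] [∀ i, Nontrivial (Γ i)]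
    (hΓ : ¬ (Fintype.card ι = 2 ∧ ∀ i, Nat.card (Γ i) = 2))
    (S : ∀ i, Set (Γ i)) (hfin : ∀ i, (S i).Finite)
    (hsymm : ∀ i, ∀ s ∈ S i, s⁻¹ ∈ S i) (hgen : ∀ i, Subgroup.closure (S i) = ⊤)
    (α : ℝ) (hα0 : 0 < α) (hα1 : α < 1) (i : ι) :
    endHausdorffDim S α (factorEnds S i) < endHausdorffDim S α (infiniteWordEnds S) := by
  obtain ⟨c, hzero, T, Y, hT, hY, hc⟩ :=
    exists_exponent_one_lt_sum_mul_sum hι Γ hΓ S hfin hgen hα0 hα1 i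
  have hcont : Continuous fun δ : ℝ≥0 => (∑ x ∈ T, (α ^ (δ : ℝ)) ^ letterLength S ⟨i, x⟩) *
      ∑ y ∈ Y, (α ^ (δ : ℝ)) ^ letterLength S y := by
    have : Continuous fun δ : ℝ≥0 => α ^ (δ : ℝ) :=
      (Real.continuous_const_rpow hα0.ne').comp NNReal.continuous_coe
    fun_prop
  obtain ⟨δ, hδ, hcδ⟩ := ((((hcont.tendsto c).eventually_const_lt hc).filter_mono
    nhdsWithin_le_nhds).and (eventually_mem_nhdsWithin (s := Set.Ioi c))).exists
  -- The vanishing holds only strictly above `c`, so an intermediate exponent separates the two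
  -- dimensions.
  obtain ⟨δ', hcδ', hδ'⟩ := exists_between (show c < δ from hcδ)
  calc endHausdorffDim S α (factorEnds S i) ≤ δ' :=
        iInf₂_le δ' (ballHausdorffMeasure_factorEnds_eq_zero hfin hgen hα0 hα1 i (hzero δ' hcδ'))
    _ < δ := by exact_mod_cast hδ'
    _ ≤ endHausdorffDim S α (infiniteWordEnds S) := by
        refine le_iInf₂ fun d hd => ?_
        by_contra! hdδ
        refine ballHausdorffMeasure_infiniteWordEnds_ne_zero hgen hα0 hα1 hT hY ?_ hd
        -- A smaller exponent increases all weights, so the product remains at least 1 at `d`.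
        have hle : α ^ (δ : ℝ) ≤ α ^ (d : ℝ) :=
          Real.rpow_le_rpow_of_exponent_ge hα0 hα1.le (by exact_mod_cast hdδ.le)
        refine hδ.le.trans ?_
        gcongr
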